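/- All graphs are finite, simple and undirected. For a graph $H$, a vertex cover is a set $C\subseteq V(H)$ meeting every edge of $H$, and $\tau(H)$ is the minimum size of a vertex cover. A connected vertex cover is a vertex cover $C$ such that the induced subgraph $H[C]$ has exactly as many connected components as $H$ has connected components with at least one edge (so $H[C]$ is connected if $H$ is connected and has an edge, and $C=\emptyset$ if $H$ has no edges); $\tau_c(H)$ is the minimum size of a connected vertex cover. Let $P_7$ be the path on $7$ vertices, $C_6$ the cycle on $6$ vertices, $\Delta_1$ the graph on $7$ vertices formed by two $4$-cycles sharing exactly one vertex, and $\Delta_2$ the graph obtained from $\Delta_1$ by removing one edge incident to its vertex of degree $4$. Theorem. For every graph $G$ the following are equivalent: (i) every induced subgraph $H$ of $G$ satisfies $\tau_c(H)\le \frac32\,\tau(H)$; (ii) $G$ is $(P_7,C_6,\Delta_1,\Delta_2)$-free, i.e. no induced subgraph of $G$ is isomorphic to $P_7$, $C_6$, $\Delta_1$ or $\Delta_2$. -/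

import Mathlib

open SimpleGraph
open scoped ENNReal

/-- `C` is a connected vertex cover of `G`: a vertex cover such that the subgraph of `G` induced by
`C` has exactly as many connected components as `G`, where the components of `G` consisting of a
single (isolated) vertex are not counted, since they have no edge to be covered. In particular, if
`G` is connected and has an edge, this says that `G.induce C` is connected. -/
def IsConnectedVertexCover {V : Type*} (G : SimpleGraph V) (C : Set V) : Prop :=
  G.IsVertexCover C ∧
    ENat.card (G.induce C).ConnectedComponent =
      ENat.card {D : G.ConnectedComponent // D.supp.Nontrivial}

/-- The connected vertex cover number: the minimum size of a connected vertex cover. -/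
noncomputable def connectedVertexCoverNum {V : Type*} (G : SimpleGraph V) : ℕ∞ :=
  ⨅ (C : Set V) (_ : IsConnectedVertexCover G C), C.encard

/-- `Δ₁`: two 4-cycles `0 1 2 3` and `0 4 5 6` sharing exactly the vertex `0`. -/
def deltaOne : SimpleGraph (Fin 7) :=
  SimpleGraph.fromEdgeSet
    {s(0, 1), s(1, 2), s(2, 3), s(3, 0), s(0, 4), s(4, 5), s(5, 6), s(6, 0)}

/-- `Δ₂`: the graph `Δ₁` with one edge at the vertex `0` of degree 4 removed (by symmetry, the
choice of the edge does not matter). -/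
def deltaTwo : SimpleGraph (Fin 7) :=
  deltaOne.deleteEdges {s(0, 1)}

/-! ### Geodesics and level functions -/

section Paths

variable {V : Type*} {G : SimpleGraph V}

/-! Sufficiency. It is enough to treat a connected graph with an edge. Let `X` be a minimum vertex
cover; its complement is independent. Call two components of `G[X]` linked if some outside vertex
has neighbours in both. A link pattern `a b c d` with neither `a, c` nor `b, d` linked would give an
induced `P₇`, so the link relation is connected without induced `P₄` or `C₄`, and some component `K`
is linked to all others. Hence outside vertices attached to `K` suffice to connect `X`; it remains
to do this with at most `|X| / 2` of them (`exists_small_connector`).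

In a minimal connecting set `Y`, every `y` has a private component, attached to no other member of
`Y`. Let `Y₁` be the members with at least two private vertices, `Y₂` the others, and `R` the
vertices outside `K` that are not private. Then `|K| + |R| + |Y| + |Y₁| ≤ |X|`, so `Y` is small
enough unless `|Y₂| > |K| + |R|`. In that case `Y₂` is replaced by one vertex for each element of
`K` and of `R`: excluding `C₆`, `Δ₁`, `Δ₂` and `P₇` forces all private vertices of the `y ∈ Y₂`
adjacent to a given `p ∈ K` to share a neighbour that is adjacent to `p`.

Necessity. Each obstruction has a vertex cover of size 3 but no connected one of size at most 4, and
`5 > 9 / 2`. -/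

theorem le_add_length_of_walk {φ : V → ℕ} (hφ : ∀ u v, G.Adj u v → φ v ≤ φ u + 1) {u v : V}
    (p : G.Walk u v) : φ v ≤ φ u + p.length := by
  induction p with
  | nil => simp
  | cons h p ih =>
    have := hφ _ _ h
    rw [Walk.length_cons]
    omega

/-- A geodesic is an induced path. -/
theorem pathGraph_isIndContained_of_le_dist {u v : V} {n : ℕ} (h : G.Reachable u v)
    (hn : n ≤ G.dist u v) : (pathGraph (n + 1)).IsIndContained G := by
  obtain ⟨p, hp⟩ := h.exists_walk_length_eq_dist
  have hd : ∀ i ≤ p.length, G.dist u (p.getVert i) = i := by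
    intro i hi
    have h1 := dist_le (p.take i)
    have h2 := dist_le (p.drop i)
    have h3 := (p.take i).reachable.dist_triangle_left v
    rw [Walk.take_length] at h1
    rw [Walk.drop_length] at h2
    omega
  have hinj : Function.Injective fun i : Fin (n + 1) ↦ p.getVert i := by
    intro i j hij
    have hi := hd i (by omega)
    have hj := hd j (by omega)
    simp only at hij
    rw [hij] at hi
    exact Fin.ext (hi.symm.trans hj)
  refine ⟨⟨⟨fun i ↦ p.getVert i, hinj⟩, fun {i j} ↦ ?_⟩⟩
  have hi := hd i (by omega)
  have hj := hd j (by omega)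
  rw [pathGraph_adj]
  change G.Adj (p.getVert i) (p.getVert j) ↔ _
  constructor
  · intro hadj
    have hne : (i : ℕ) ≠ j := by
      rintro e
      rw [e] at hadj
      exact hadj.ne rfl
    have h1 := hadj.reachable.dist_triangle_right u
    have h2 := hadj.symm.reachable.dist_triangle_right u
    rw [dist_eq_one_iff_adj.2 hadj] at h1
    rw [dist_eq_one_iff_adj.2 hadj.symm] at h2
    omega
  · rintro (hij | hij)
    · rw [← hij]
      exact p.adj_getVert_succ (by omega)
    · rw [← hij]
      exact (p.adj_getVert_succ (by omega)).symm

/-- A function rising by at most one along each edge bounds the distance from its zeros from below,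
so the start of a geodesic is the required path. -/
theorem pathGraph_isIndContained_of_level (φ : V → ℕ) (hφ : ∀ u v, G.Adj u v → φ v ≤ φ u + 1)
    {u v : V} {n : ℕ} (h : G.Reachable u v) (hu : φ u = 0) (hv : n ≤ φ v) :
    (pathGraph (n + 1)).IsIndContained G := by
  refine pathGraph_isIndContained_of_le_dist h ?_
  obtain ⟨p, hp⟩ := h.exists_walk_length_eq_dist
  have := le_add_length_of_walk hφ p
  omega

end Paths

/-! ### Universal elements of relations without induced `P₄` and `C₄` -/

/-- A connected reflexive symmetric relation without induced `P₄` or `C₄` on a finite type has a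
universal element. -/
theorem exists_universal_of_no_induced_four {α : Type*} [Finite α] [Nonempty α] (D : α → α → Prop)
    (hr : ∀ a, D a a) (hs : ∀ a b, D a b → D b a)
    (hc : ∀ a b, Relation.ReflTransGen D a b)
    (h4 : ∀ a b c d, D a b → D b c → D c d → D a c ∨ D b d) : ∃ a, ∀ b, D a b := by
  obtain ⟨a, ha⟩ := Finite.exists_max fun a ↦ {b | D a b}.ncard
  refine ⟨a, fun b ↦ ?_⟩
  by_contra hb
  obtain ⟨l, k, hal, hlk, hak⟩ : ∃ l k, D a l ∧ D l k ∧ ¬ D a k := by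
    by_contra! hcon
    have : ∀ c, Relation.ReflTransGen D a c → D a c := by
      intro c hc'
      induction hc' with
      | refl => exact hr a
      | tail _ h ih => exact hcon _ _ ih h
    exact hb (this b (hc a b))
  have hsub : ¬ {b | D a b} ⊆ {b | D l b} := by
    intro hsub
    have := Set.eq_of_subset_of_ncard_le hsub (ha l) (Set.toFinite _)
    have hk : k ∈ {b | D l b} := hlk
    rw [← this] at hk
    exact hak hk
  obtain ⟨m, hm, hml⟩ := Set.not_subset.1 hsub
  rcases h4 m a l k (hs _ _ hm) hal hlk with h | h
  · exact hml (hs _ _ h)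
  · exact hak h

/-! ### Components of the cover and the link relation -/

section Attached

variable {V : Type*}

/-- `u` and `v` lie in the same connected component of the subgraph induced by `W`. -/
def ReachableIn (G : SimpleGraph V) (W : Set V) (u v : V) : Prop :=
  ∃ (hu : u ∈ W) (hv : v ∈ W), (G.induce W).Reachable ⟨u, hu⟩ ⟨v, hv⟩

/-- `i` has a neighbour in the component of `v` in the subgraph induced by `X`. -/
def Attached (G : SimpleGraph V) (X : Set V) (i v : V) : Prop :=
  ∃ u, ReachableIn G X u v ∧ G.Adj i u

/-- `u` and `v` lie in the same component of the subgraph induced by `X`, or their components are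
attached to a common vertex outside of `X`. -/
def Linked (G : SimpleGraph V) (X : Set V) (u v : V) : Prop :=
  ReachableIn G X u v ∨ ∃ i ∉ X, Attached G X i u ∧ Attached G X i v

variable {G : SimpleGraph V} {W X : Set V} {u v w i : V}

namespace ReachableIn

theorem refl (h : u ∈ W) : ReachableIn G W u u := ⟨h, h, Reachable.refl _⟩

theorem symm (h : ReachableIn G W u v) : ReachableIn G W v u :=
  let ⟨hu, hv, h⟩ := h; ⟨hv, hu, h.symm⟩

theorem trans (h : ReachableIn G W u v) (h' : ReachableIn G W v w) : ReachableIn G W u w :=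
  let ⟨hu, _, h⟩ := h; let ⟨_, hw, h'⟩ := h'; ⟨hu, hw, h.trans h'⟩

theorem mem_left (h : ReachableIn G W u v) : u ∈ W := h.1

theorem of_adj (hu : u ∈ W) (hv : v ∈ W) (h : G.Adj u v) : ReachableIn G W u v :=
  ⟨hu, hv, Adj.reachable (by simpa using h)⟩

theorem mono (h : ReachableIn G X u v) (hXW : X ⊆ W) : ReachableIn G W u v :=
  let ⟨hu, hv, h⟩ := h
  ⟨hXW hu, hXW hv, h.map (G.induceHomOfLE hXW).toHom⟩

/-- The component of `v` in the subgraph induced by `X` is itself connected. -/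
theorem of_component (h : ReachableIn G X u v) (hW : ∀ w, ReachableIn G X w v → w ∈ W) :
    ReachableIn G W u v := by
  obtain ⟨hu, hv, p⟩ := h
  have : ∀ x : X, (G.induce X).Reachable x ⟨v, hv⟩ → ReachableIn G W x v := by
    intro x hx
    obtain ⟨p⟩ := hx
    have key : ∀ (x y : X) (p : (G.induce X).Walk x y), (y : V) = v → ReachableIn G W x v := by
      intro x y p
      induction p with
      | nil => intro e; rw [e]; exact refl (hW _ (refl hv))
      | @cons a b c hab q ih =>
        intro e
        have hb := ih e
        have hc : c = ⟨v, hv⟩ := Subtype.ext e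
        subst hc
        have hbv : ReachableIn G X b v := ⟨b.2, hv, q.reachable⟩
        have hab' : G.Adj a b := by simpa using hab
        exact (of_adj (hW _ ((of_adj a.2 b.2 hab').trans hbv)) hb.mem_left hab').trans hb
    exact key _ _ p rfl
  exact this ⟨u, hu⟩ p

end ReachableIn

theorem Attached.congr (h : Attached G X i u) (huv : ReachableIn G X u v) : Attached G X i v :=
  let ⟨w, hw, hi⟩ := h; ⟨w, hw.trans huv, hi⟩

theorem Attached.of_adj (hv : v ∈ X) (h : G.Adj i v) : Attached G X i v :=
  ⟨v, ReachableIn.refl hv, h⟩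

theorem Linked.symm (h : Linked G X u v) : Linked G X v u :=
  h.elim (fun h ↦ .inl h.symm) fun ⟨i, hi, h, h'⟩ ↦ .inr ⟨i, hi, h', h⟩

theorem Linked.congr (h : Linked G X u v) (hvw : ReachableIn G X v w) : Linked G X u w :=
  h.elim (fun h ↦ .inl (h.trans hvw)) fun ⟨i, hi, h, h'⟩ ↦ .inr ⟨i, hi, h, h'.congr hvw⟩

/-- Four components forming an induced path or cycle with respect to `Linked` yield an induced
path on seven vertices. -/
theorem pathGraph_seven_isIndContained_of_linked (hX : G.IsVertexCover X) {a b c d : V}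
    (hab : Linked G X a b) (hbc : Linked G X b c) (hcd : Linked G X c d)
    (hac : ¬ Linked G X a c) (hbd : ¬ Linked G X b d) : (pathGraph 7).IsIndContained G := by
  classical
  obtain ⟨i, hi, hia, hib⟩ := hab.resolve_left fun h ↦ hac (hbc.symm.congr h.symm).symm
  obtain ⟨j, hj, hjb, hjc⟩ := hbc.resolve_left fun h ↦ hac (hab.congr h)
  obtain ⟨k, hk, hkc, hkd⟩ := hcd.resolve_left fun h ↦ hbd (hbc.congr h)
  have nic : ¬ Attached G X i c := fun h ↦ hac (.inr ⟨i, hi, hia, h⟩)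
  have nid : ¬ Attached G X i d := fun h ↦ hbd (.inr ⟨i, hi, hib, h⟩)
  have nja : ¬ Attached G X j a := fun h ↦ hac (.inr ⟨j, hj, h, hjc⟩)
  have njd : ¬ Attached G X j d := fun h ↦ hbd (.inr ⟨j, hj, hjb, h⟩)
  have nka : ¬ Attached G X k a := fun h ↦ hac (.inr ⟨k, hk, h, hkc⟩)
  have nkb : ¬ Attached G X k b := fun h ↦ hbd (.inr ⟨k, hk, h, hkd⟩)
  let W : Set V := {v | v = i ∨ v = j ∨ v = k ∨ ReachableIn G X v a ∨ ReachableIn G X v b ∨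
    ReachableIn G X v c ∨ ReachableIn G X v d}
  -- The components may be large, so no explicit path is written down. Levels 0 to 6 run through `a,
  -- i, b, j, c, k, d`; within `W` no edge skips a level, which puts the two ends at distance at
  -- least 6. A possible link between `a` and `d` is harmless, as its vertex is not in `W`.
  let φ : V → ℕ := fun v ↦ if ReachableIn G X v a then 0 else if v = i then 1 else
    if ReachableIn G X v b then 2 else if v = j then 3 else
    if ReachableIn G X v c then 4 else if v = k then 5 else 6
  obtain ⟨ia, hia', hiia⟩ := hia
  obtain ⟨ib, hib', hiib⟩ := hib
  obtain ⟨jb, hjb', hjjb⟩ := hjb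
  obtain ⟨jc, hjc', hjjc⟩ := hjc
  obtain ⟨kc, hkc', hkkc⟩ := hkc
  obtain ⟨kd, hkd', hkkd⟩ := hkd
  have hWi : i ∈ W := .inl rfl
  have hWj : j ∈ W := .inr (.inl rfl)
  have hWk : k ∈ W := .inr (.inr (.inl rfl))
  have hWa : ∀ w, ReachableIn G X w a → w ∈ W := fun w h ↦ by simp [W, h]
  have hWb : ∀ w, ReachableIn G X w b → w ∈ W := fun w h ↦ by simp [W, h]
  have hWc : ∀ w, ReachableIn G X w c → w ∈ W := fun w h ↦ by simp [W, h]
  have hWd : ∀ w, ReachableIn G X w d → w ∈ W := fun w h ↦ by simp [W, h]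
  have hreach : ReachableIn G W ia kd := by
    refine (ReachableIn.of_adj (hWa _ hia') hWi hiia.symm).trans ?_
    refine (ReachableIn.of_adj hWi (hWb _ hib') hiib).trans ?_
    refine ((hib'.of_component hWb).trans (hjb'.of_component hWb).symm).trans ?_
    refine (ReachableIn.of_adj (hWb _ hjb') hWj hjjb.symm).trans ?_
    refine (ReachableIn.of_adj hWj (hWc _ hjc') hjjc).trans ?_
    refine ((hjc'.of_component hWc).trans (hkc'.of_component hWc).symm).trans ?_
    exact (ReachableIn.of_adj (hWc _ hkc') hWk hkkc.symm).trans
      (ReachableIn.of_adj hWk (hWd _ hkd') hkkd)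
  have nab : ¬ ReachableIn G X a b := fun h ↦ hac (hbc.symm.congr h.symm).symm
  have nbc : ¬ ReachableIn G X b c := fun h ↦ hac (hab.congr h)
  have ncd : ¬ ReachableIn G X c d := fun h ↦ hbd (hbc.congr h)
  have nac : ¬ ReachableIn G X a c := fun h ↦ hac (.inl h)
  have nbd : ¬ ReachableIn G X b d := fun h ↦ hbd (.inl h)
  have nad : ¬ ReachableIn G X a d := fun h ↦ hac (hcd.congr h.symm).symm
  have φa : ∀ w, ReachableIn G X w a → φ w = 0 := fun w h ↦ by simp [φ, h]
  have φi : φ i = 1 := by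
    have : ¬ ReachableIn G X i a := fun h ↦ hi h.mem_left
    simp [φ, this]
  have φb : ∀ w, ReachableIn G X w b → φ w = 2 := by
    intro w h
    have h1 : ¬ ReachableIn G X w a := fun h' ↦ nab (h'.symm.trans h)
    have h2 : w ≠ i := fun e ↦ hi (e ▸ h.mem_left)
    simp [φ, h, h1, h2]
  have φj : φ j = 3 := by
    have h1 : ∀ x, ¬ ReachableIn G X j x := fun x h ↦ hj h.mem_left
    have h2 : j ≠ i := fun e ↦ nja (e ▸ ⟨ia, hia', hiia⟩)
    simp [φ, h1, h2]
  have φc : ∀ w, ReachableIn G X w c → φ w = 4 := by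
    intro w h
    have h1 : ¬ ReachableIn G X w a := fun h' ↦ nac (h'.symm.trans h)
    have h2 : ¬ ReachableIn G X w b := fun h' ↦ nbc (h'.symm.trans h)
    have h3 : w ≠ i := fun e ↦ hi (e ▸ h.mem_left)
    have h4 : w ≠ j := fun e ↦ hj (e ▸ h.mem_left)
    simp [φ, h, h1, h2, h3, h4]
  have φk : φ k = 5 := by
    have h1 : ∀ x, ¬ ReachableIn G X k x := fun x h ↦ hk h.mem_left
    have h2 : k ≠ i := fun e ↦ nka (e ▸ ⟨ia, hia', hiia⟩)
    have h3 : k ≠ j := fun e ↦ nkb (e ▸ ⟨jb, hjb', hjjb⟩)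
    simp [φ, h1, h2, h3]
  have φd : ∀ w, ReachableIn G X w d → φ w = 6 := by
    intro w h
    have h1 : ¬ ReachableIn G X w a := fun h' ↦ nad (h'.symm.trans h)
    have h2 : ¬ ReachableIn G X w b := fun h' ↦ nbd (h'.symm.trans h)
    have h3 : ¬ ReachableIn G X w c := fun h' ↦ ncd (h'.symm.trans h)
    have h4 : w ≠ i := fun e ↦ hi (e ▸ h.mem_left)
    have h5 : w ≠ j := fun e ↦ hj (e ▸ h.mem_left)
    have h6 : w ≠ k := fun e ↦ hk (e ▸ h.mem_left)
    simp [φ, h1, h2, h3, h4, h5, h6]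
  have hXX : ∀ {x y u v : V}, ReachableIn G X u x → ReachableIn G X v y → G.Adj u v →
      ReachableIn G X x y := fun hu hv h ↦
    hu.symm.trans ((ReachableIn.of_adj hu.mem_left hv.mem_left h).trans hv)
  have hW : ∀ u ∈ W, (u = i ∧ φ u = 1) ∨ (u = j ∧ φ u = 3) ∨ (u = k ∧ φ u = 5) ∨
      (ReachableIn G X u a ∧ φ u = 0) ∨ (ReachableIn G X u b ∧ φ u = 2) ∨
      (ReachableIn G X u c ∧ φ u = 4) ∨ (ReachableIn G X u d ∧ φ u = 6) := by
    rintro u (rfl | rfl | rfl | h | h | h | h) <;> simp [*]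
  have hlip : ∀ u ∈ W, ∀ v ∈ W, G.Adj u v → φ v ≤ φ u + 1 := by
    intro u hu v hv h
    rcases hW u hu with ⟨rfl, eu⟩ | ⟨rfl, eu⟩ | ⟨rfl, eu⟩ | ⟨hu', eu⟩ | ⟨hu', eu⟩ | ⟨hu', eu⟩ |
      ⟨hu', eu⟩ <;>
      rcases hW v hv with ⟨rfl, ev⟩ | ⟨rfl, ev⟩ | ⟨rfl, ev⟩ | ⟨hv', ev⟩ | ⟨hv', ev⟩ | ⟨hv', ev⟩ |
        ⟨hv', ev⟩ <;>
      first
      | omega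
      | exact absurd (hXX hu' hv' h) ‹_›
      | exact absurd (⟨_, hu', h.symm⟩ : Attached G X _ _) ‹_›
      | exact absurd (⟨_, hv', h⟩ : Attached G X _ _) ‹_›
      | exact (hX h).elim (fun h ↦ absurd h ‹_›) (fun h ↦ absurd h ‹_›)
  obtain ⟨hu, hv, hr⟩ := hreach
  have hP : (pathGraph 7).IsIndContained (G.induce W) :=
    pathGraph_isIndContained_of_level (fun w : W ↦ φ w)
      (fun u v h ↦ hlip u u.2 v v.2 (by simpa using h)) hr (φa _ hia') (φd _ hkd').ge
  exact hP.trans ⟨Embedding.induce W⟩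

end Attached

/-! ### The universal component and the local obstructions -/

section Connected

variable {V : Type*} {G : SimpleGraph V}

/-- The link relation inherits connectedness from `G`: a walk that leaves `X` returns to it at the
next step, because the complement of `X` is independent. -/
theorem exists_forall_linked [Finite V] (hG : G.Connected) {X : Set V} (hX : G.IsVertexCover X)
    (hne : X.Nonempty) (hP : ¬ (pathGraph 7).IsIndContained G) :
    ∃ k ∈ X, ∀ v ∈ X, Linked G X k v := by
  have : Nonempty X := hne.to_subtype
  have hD : ∀ a b, Relation.ReflTransGen (fun u v : X ↦ Linked G X u v) a b := by
    intro a b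
    have key : ∀ v, Relation.ReflTransGen G.Adj a v →
        (∀ h : v ∈ X, Relation.ReflTransGen (fun u v : X ↦ Linked G X u v) a ⟨v, h⟩) ∧
        (v ∉ X → ∃ w : X, Relation.ReflTransGen (fun u v : X ↦ Linked G X u v) a w ∧
          Attached G X v w) := by
      intro v h
      induction h with
      | refl => exact ⟨fun _ ↦ .refl, fun h ↦ absurd a.2 h⟩
      | @tail u v _ huv ih =>
        refine ⟨fun hv ↦ ?_, fun hv ↦ ?_⟩
        · by_cases hu : u ∈ X
          · exact (ih.1 hu).tail (.inl (.of_adj hu hv huv))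
          · obtain ⟨w, hw, huw⟩ := ih.2 hu
            exact hw.tail (.inr ⟨u, hu, huw, .of_adj hv huv⟩)
        · have hu : u ∈ X := (hX huv).resolve_right hv
          exact ⟨⟨u, hu⟩, ih.1 hu, .of_adj hu huv.symm⟩
    exact (key b ((reachable_iff_reflTransGen _ _).1 (hG a b))).1 b.2
  obtain ⟨⟨k, hk⟩, h⟩ := exists_universal_of_no_induced_four (fun u v : X ↦ Linked G X u v)
    (fun a ↦ .inl (.refl a.2)) (fun a b h ↦ h.symm) hD fun a b c d hab hbc hcd ↦ by
      by_contra! hcon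
      exact hP (pathGraph_seven_isIndContained_of_linked hX hab hbc hcd hcon.1 hcon.2)
  exact ⟨k, hk, fun v hv ↦ h ⟨v, hv⟩⟩

theorem induce_union_connected {X Y : Set V} {k : V} (hk : k ∈ X)
    (hYk : ∀ y ∈ Y, Attached G X y k)
    (hY : ∀ v ∈ X, ¬ ReachableIn G X v k → ∃ y ∈ Y, Attached G X y v) :
    (G.induce (X ∪ Y)).Connected := by
  rw [connected_iff_exists_forall_reachable]
  have hatt : ∀ y ∈ Y, ∀ v, Attached G X y v → ReachableIn G (X ∪ Y) v y := by
    rintro y hy v ⟨u, huv, hyu⟩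
    exact (huv.symm.mono Set.subset_union_left).trans
      (.of_adj (.inl huv.mem_left) (.inr hy) hyu.symm)
  have key : ∀ v ∈ X ∪ Y, ReachableIn G (X ∪ Y) k v := by
    rintro v (hv | hv)
    · by_cases hvk : ReachableIn G X v k
      · exact hvk.symm.mono Set.subset_union_left
      · obtain ⟨y, hy, hyv⟩ := hY v hv hvk
        exact (hatt y hy k (hYk y hy)).trans (hatt y hy v hyv).symm
    · exact hatt v hv k (hYk v hv)
  exact ⟨⟨k, .inl hk⟩, fun ⟨v, hv⟩ ↦ (key v hv).2.2⟩

theorem isIndContained_of_forall_lt {n : ℕ} {L : SimpleGraph (Fin n)} (f : Fin n → V)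
    (h : ∀ i j, i < j → f i ≠ f j ∧ (G.Adj (f i) (f j) ↔ L.Adj i j)) : L.IsIndContained G := by
  have hinj : Function.Injective f := by
    intro i j hij
    by_contra hne
    rcases lt_or_gt_of_ne hne with hlt | hlt
    · exact (h i j hlt).1 hij
    · exact (h j i hlt).1 hij.symm
  refine ⟨⟨⟨f, hinj⟩, fun {i j} ↦ ?_⟩⟩
  change G.Adj (f i) (f j) ↔ L.Adj i j
  rcases lt_trichotomy i j with hlt | rfl | hlt
  · exact (h i j hlt).2
  · simp
  · rw [G.adj_comm, L.adj_comm]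
    exact (h j i hlt).2

/-- Two disjoint paths `y x z` both of whose first vertices are adjacent to `p` form one of the
obstructions on seven vertices with `p`. -/
theorem isIndContained_of_two_legs {X : Set V} (hX : G.IsVertexCover X) {p x₁ x₂ y₁ y₂ z₁ z₂ : V}
    (hy₁ : y₁ ∉ X) (hy₂ : y₂ ∉ X) (hz₁ : z₁ ∉ X) (hz₂ : z₂ ∉ X)
    (hxy₁ : G.Adj y₁ x₁) (hxz₁ : G.Adj z₁ x₁) (hxy₂ : G.Adj y₂ x₂) (hxz₂ : G.Adj z₂ x₂)
    (hpy₁ : G.Adj y₁ p) (hpy₂ : G.Adj y₂ p) (hxx : ¬ G.Adj x₁ x₂) (hxp₁ : ¬ G.Adj x₁ p)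
    (hxp₂ : ¬ G.Adj x₂ p) (hyx₁ : ¬ G.Adj y₁ x₂) (hyx₂ : ¬ G.Adj y₂ x₁)
    (hzx₁ : ¬ G.Adj z₁ x₂) (hzx₂ : ¬ G.Adj z₂ x₁) (hyz₁ : y₁ ≠ z₁) (hyz₂ : y₂ ≠ z₂) :
    (pathGraph 7).IsIndContained G ∨ deltaOne.IsIndContained G ∨ deltaTwo.IsIndContained G := by
  have hI : ∀ {u v}, u ∉ X → v ∉ X → ¬ G.Adj u v := fun hu hv h ↦ (hX h).elim hu hv
  have hpX : p ∈ X := (hX hpy₁).resolve_left hy₁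
  have hx₁X : x₁ ∈ X := (hX hxy₁).resolve_left hy₁
  have hx₂X : x₂ ∈ X := (hX hxy₂).resolve_left hy₂
  have hne : ∀ {u v}, u ∉ X → v ∈ X → u ≠ v := fun hu hv h ↦ hu (h ▸ hv)
  have e1 : x₁ ≠ x₂ := by rintro rfl; exact hyx₁ hxy₁
  have e2 : x₁ ≠ p := by rintro rfl; exact hyx₂ hpy₂
  have e3 : x₂ ≠ p := by rintro rfl; exact hyx₁ hpy₁
  have e4 : y₁ ≠ y₂ := by rintro rfl; exact hyx₁ hxy₂
  have e5 : z₁ ≠ z₂ := by rintro rfl; exact hzx₁ hxz₂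
  have e6 : y₁ ≠ z₂ := by rintro rfl; exact hyx₁ hxz₂
  have e7 : z₁ ≠ y₂ := by rintro rfl; exact hzx₁ hxy₂
  have f1 := hI hy₁ hy₂
  have f2 := hI hy₁ hz₁
  have f3 := hI hy₁ hz₂
  have f4 := hI hz₁ hy₂
  have f5 := hI hy₂ hz₂
  have f6 := hI hz₁ hz₂
  have g1 := hne hy₁ hpX
  have g2 := hne hy₁ hx₁X
  have g3 := hne hy₁ hx₂X
  have g4 := hne hy₂ hpX
  have g5 := hne hy₂ hx₁X
  have g6 := hne hy₂ hx₂X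
  have g7 := hne hz₁ hpX
  have g8 := hne hz₁ hx₁X
  have g9 := hne hz₁ hx₂X
  have g10 := hne hz₂ hpX
  have g11 := hne hz₂ hx₁X
  have g12 := hne hz₂ hx₂X
  have hcomm := G.adj_comm
  -- Only the edges from `z₁` and `z₂` to `p` are undetermined; each one present closes a leg to a
  -- 4-cycle through `p`.
  by_cases h₁ : G.Adj z₁ p <;> by_cases h₂ : G.Adj z₂ p
  · refine .inr (.inl (isIndContained_of_forall_lt ![p, y₁, x₁, z₁, y₂, x₂, z₂] ?_))
    simp only [Fin.forall_fin_succ, deltaOne]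
    simp
    grind only
  · refine .inr (.inr (isIndContained_of_forall_lt ![p, z₂, x₂, y₂, y₁, x₁, z₁] ?_))
    simp only [Fin.forall_fin_succ, deltaOne, deltaTwo]
    simp
    grind only
  · refine .inr (.inr (isIndContained_of_forall_lt ![p, z₁, x₁, y₁, y₂, x₂, z₂] ?_))
    simp only [Fin.forall_fin_succ, deltaOne, deltaTwo]
    simp
    grind only
  · refine .inl (isIndContained_of_forall_lt ![z₁, x₁, y₁, p, y₂, x₂, z₂] ?_)
    simp only [Fin.forall_fin_succ, pathGraph_adj]
    simp
    grind only

theorem cycleGraph_six_isIndContained {X : Set V} (hX : G.IsVertexCover X) {p x₁ x₂ y₁ y₂ z : V}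
    (hy₁ : y₁ ∉ X) (hy₂ : y₂ ∉ X) (hz : z ∉ X)
    (hxy₁ : G.Adj y₁ x₁) (hxz₁ : G.Adj z x₁) (hxy₂ : G.Adj y₂ x₂) (hxz₂ : G.Adj z x₂)
    (hpy₁ : G.Adj y₁ p) (hpy₂ : G.Adj y₂ p) (hxx : ¬ G.Adj x₁ x₂) (hxp₁ : ¬ G.Adj x₁ p)
    (hxp₂ : ¬ G.Adj x₂ p) (hyx₁ : ¬ G.Adj y₁ x₂) (hyx₂ : ¬ G.Adj y₂ x₁) (hzp : ¬ G.Adj z p) :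
    (cycleGraph 6).IsIndContained G := by
  have hI : ∀ {u v}, u ∉ X → v ∉ X → ¬ G.Adj u v := fun hu hv h ↦ (hX h).elim hu hv
  have hpX : p ∈ X := (hX hpy₁).resolve_left hy₁
  have hx₁X : x₁ ∈ X := (hX hxy₁).resolve_left hy₁
  have hx₂X : x₂ ∈ X := (hX hxy₂).resolve_left hy₂
  have hne : ∀ {u v}, u ∉ X → v ∈ X → u ≠ v := fun hu hv h ↦ hu (h ▸ hv)
  have e1 : x₁ ≠ x₂ := by rintro rfl; exact hyx₁ hxy₁
  have e2 : x₁ ≠ p := by rintro rfl; exact hyx₂ hpy₂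
  have e3 : x₂ ≠ p := by rintro rfl; exact hyx₁ hpy₁
  have e4 : y₁ ≠ y₂ := by rintro rfl; exact hyx₁ hxy₂
  have e5 : y₁ ≠ z := by rintro rfl; exact hzp hpy₁
  have e6 : y₂ ≠ z := by rintro rfl; exact hzp hpy₂
  have f1 := hI hy₁ hy₂
  have f2 := hI hy₁ hz
  have f3 := hI hy₂ hz
  have g1 := hne hy₁ hpX
  have g2 := hne hy₁ hx₁X
  have g3 := hne hy₁ hx₂X
  have g4 := hne hy₂ hpX
  have g5 := hne hy₂ hx₁X
  have g6 := hne hy₂ hx₂X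
  have g7 := hne hz hpX
  have g8 := hne hz hx₁X
  have g9 := hne hz hx₂X
  have hcomm := G.adj_comm
  refine isIndContained_of_forall_lt ![p, y₁, x₁, z, x₂, y₂] ?_
  simp only [Fin.forall_fin_succ, cycleGraph_adj']
  simp
  grind only

end Connected

/-! ### Small connecting sets -/

section Connectors

variable {V : Type*} {G : SimpleGraph V}

/-- There is a minimum vertex cover such that no isolated vertex of its induced subgraph is a
pendant vertex of a vertex that has a further neighbour in the cover. -/
theorem exists_minimum_vertexCover [Fintype V] [DecidableEq V] (G : SimpleGraph V) :
    ∃ X : Finset V, G.IsVertexCover X ∧ (∀ X' : Finset V, G.IsVertexCover X' → X.card ≤ X'.card) ∧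
      ∀ x ∈ X, (∀ u ∈ X, ¬ G.Adj x u) → ∀ y ∉ X, G.Adj y x → ∀ k ∈ X, k ≠ x → G.Adj y k →
        ∃ z, z ≠ y ∧ G.Adj z x := by
  classical
  let covers : Finset (Finset V) := Finset.univ.filter fun X ↦ G.IsVertexCover X
  have hne : covers.Nonempty := ⟨Finset.univ, by simp [covers]⟩
  obtain ⟨X₀, hX₀, hmin₀⟩ := Finset.exists_min_image covers Finset.card hne
  let iso : Finset V → Finset V := fun X ↦ X.filter fun v ↦ ∀ u ∈ X, ¬ G.Adj v u
  -- Among the minimum covers, one with fewest isolated vertices in its induced subgraph. If `y`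
  -- were the only neighbour of an isolated `x`, exchanging `x` for `y` would keep a cover of
  -- minimum size and lower that number, since `y` has the neighbour `k`.
  obtain ⟨X, hX, hmin⟩ := Finset.exists_min_image (covers.filter fun X ↦ X.card ≤ X₀.card)
    (fun X ↦ (iso X).card) ⟨X₀, by simp [hX₀]⟩
  simp only [covers, Finset.mem_filter, Finset.mem_univ, true_and] at hX hX₀ hmin hmin₀
  refine ⟨X, hX.1, fun X' h ↦ hX.2.trans (hmin₀ X' h), ?_⟩
  intro x hx hiso y hy hyx k hk hkx hyk
  by_contra! hcon
  have hcov : G.IsVertexCover (insert y (X.erase x) : Finset V) := by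
    intro u v huv
    simp only [Finset.coe_insert, Finset.coe_erase, Set.mem_insert_iff, Set.mem_sdiff,
      Finset.mem_coe, Set.mem_singleton_iff]
    have h1 := hX.1 huv
    simp only [Finset.mem_coe] at h1
    by_cases hu : u = x
    · subst hu
      by_cases hv : v = y
      · exact .inr (.inl hv)
      · exact absurd huv.symm (hcon v hv)
    · by_cases hv : v = x
      · subst hv
        by_cases hu : u = y
        · exact .inl (.inl hu)
        · exact absurd huv (hcon u hu)
      · tauto
  have hcard : (insert y (X.erase x)).card ≤ X₀.card := by
    refine (Finset.card_insert_le _ _).trans ?_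
    rw [Finset.card_erase_add_one hx]
    exact hX.2
  have hlt : (iso (insert y (X.erase x))).card < (iso X).card := by
    refine Finset.card_lt_card ⟨fun v hv ↦ ?_, fun hsub ↦ ?_⟩
    · simp only [iso, Finset.mem_filter, Finset.mem_insert, Finset.mem_erase] at hv ⊢
      obtain ⟨rfl | ⟨hvx, hv⟩, h⟩ := hv
      · exact absurd hyk (h k (.inr ⟨hkx, hk⟩))
      · refine ⟨hv, fun u hu huv ↦ ?_⟩
        by_cases hux : u = x
        · subst hux
          exact hcon v (fun e ↦ hy (e ▸ hv)) huv
        · exact h u (.inr ⟨hux, hu⟩) huv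
    · have : x ∈ iso X := by simpa [iso, hx] using hiso
      have := hsub this
      simp only [iso, Finset.mem_filter, Finset.mem_insert, Finset.mem_erase, ne_eq,
        not_true_eq_false, false_and, or_false] at this
      exact hy (this.1 ▸ hx)
  exact absurd (hmin _ ⟨hcov, hcard⟩) hlt.not_ge

variable [DecidableEq V]

/-- `v ∈ X` lies outside of the component of `k`, and `y` is the only vertex of `Y` attached to the
component of `v`. -/
def IsPrivate (G : SimpleGraph V) (X Y : Finset V) (k y v : V) : Prop :=
  v ∈ X ∧ ¬ ReachableIn G X v k ∧ Attached G X y v ∧ ∀ y' ∈ Y, Attached G X y' v → y' = y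

/-- The vertices of `Y` connect all components of the subgraph induced by `X` with the component
of `k`. -/
def IsConnector (G : SimpleGraph V) (X : Finset V) (k : V) (Y : Finset V) : Prop :=
  (∀ y ∈ Y, y ∉ X ∧ Attached G X y k) ∧
    ∀ v ∈ X, ¬ ReachableIn G X v k → ∃ y ∈ Y, Attached G X y v

variable {X Y : Finset V} {k y v : V}

/-- In a connector of minimum size no vertex can be dropped, so each is the only one attached to
some component. -/
theorem exists_connector_with_private [Fintype V] (h : ∀ v ∈ X, Linked G X k v) :
    ∃ Y, IsConnector G X k Y ∧ ∀ y ∈ Y, ∃ v, IsPrivate G X Y k y v := by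
  classical
  let Y₀ : Finset V := Finset.univ.filter fun y ↦ y ∉ X ∧ Attached G X y k
  have hY₀ : IsConnector G X k Y₀ := by
    refine ⟨fun y hy ↦ by simpa [Y₀] using hy, fun v hv hvk ↦ ?_⟩
    obtain ⟨i, hi, hik, hiv⟩ := (h v hv).resolve_left fun h ↦ hvk h.symm
    exact ⟨i, by simpa [Y₀] using ⟨hi, hik⟩, hiv⟩
  obtain ⟨Y, hY, hmin⟩ := Finset.exists_min_image
    (Finset.univ.filter fun Y ↦ IsConnector G X k Y) Finset.card ⟨Y₀, by simpa using hY₀⟩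
  simp only [Finset.mem_filter, Finset.mem_univ, true_and] at hY hmin
  refine ⟨Y, hY, fun y hy ↦ ?_⟩
  by_contra! hcon
  have : IsConnector G X k (Y.erase y) := by
    refine ⟨fun y' hy' ↦ hY.1 y' (Finset.mem_of_mem_erase hy'), fun v hv hvk ↦ ?_⟩
    obtain ⟨y', hy', hv'⟩ := hY.2 v hv hvk
    by_cases e : y' = y
    · subst e
      have h1 := hcon v
      simp only [IsPrivate, not_and, not_forall] at h1
      obtain ⟨w, hw, hwv, hne⟩ := h1 hv hvk hv'
      exact ⟨w, Finset.mem_erase.2 ⟨hne, hw⟩, hwv⟩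
    · exact ⟨y', Finset.mem_erase.2 ⟨e, hy'⟩, hv'⟩
  have h1 := hmin _ this
  rw [Finset.card_erase_of_mem hy] at h1
  have h2 := Finset.card_pos.2 ⟨y, hy⟩
  omega

/-- The private vertices of a connector bound its size. -/
theorem card_add_card_le_of_private {K R Y₁ : Finset V} {f f' : V → V}
    (hK : ∀ v ∈ K, v ∈ X ∧ ReachableIn G X v k)
    (hR : ∀ v ∈ R, v ∈ X ∧ ¬ ReachableIn G X v k ∧ ∀ y ∈ Y, ¬ IsPrivate G X Y k y v)
    (hY₁ : Y₁ ⊆ Y) (hf : ∀ y ∈ Y, IsPrivate G X Y k y (f y))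
    (hf' : ∀ y ∈ Y₁, IsPrivate G X Y k y (f' y) ∧ f' y ≠ f y) :
    K.card + R.card + Y.card + Y₁.card ≤ X.card := by
  have huniq : ∀ {y y' v}, y ∈ Y → IsPrivate G X Y k y v → IsPrivate G X Y k y' v → y = y' :=
    fun hy h h' ↦ h'.2.2.2 _ hy h.2.2.1
  have c1 : (Y.image f).card = Y.card := Finset.card_image_of_injOn fun y hy y' hy' e ↦
    huniq hy (hf y hy) (by rw [show f y = f y' from e]; exact hf y' hy')
  have c2 : (Y₁.image f').card = Y₁.card := Finset.card_image_of_injOn fun y hy y' hy' e ↦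
    huniq (hY₁ hy) (hf' y hy).1 (by rw [show f' y = f' y' from e]; exact (hf' y' hy').1)
  have d1 : Disjoint K R := Finset.disjoint_left.2 fun v hv hv' ↦ (hR v hv').2.1 (hK v hv).2
  have d2 : Disjoint (K ∪ R) (Y.image f) := by
    refine Finset.disjoint_left.2 fun v hv hv' ↦ ?_
    obtain ⟨y, hy, rfl⟩ := Finset.mem_image.1 hv'
    rcases Finset.mem_union.1 hv with hv | hv
    · exact (hf y hy).2.1 (hK _ hv).2
    · exact (hR _ hv).2.2 y hy (hf y hy)
  have d3 : Disjoint (K ∪ R ∪ Y.image f) (Y₁.image f') := by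
    refine Finset.disjoint_left.2 fun v hv hv' ↦ ?_
    obtain ⟨y, hy, rfl⟩ := Finset.mem_image.1 hv'
    rcases Finset.mem_union.1 hv with hv | hv
    · rcases Finset.mem_union.1 hv with hv | hv
      · exact (hf' y hy).1.2.1 (hK _ hv).2
      · exact (hR _ hv).2.2 y (hY₁ hy) (hf' y hy).1
    · obtain ⟨y', hy', e⟩ := Finset.mem_image.1 hv
      have h1 := hf y' hy'
      rw [e] at h1
      have := huniq hy' h1 (hf' y hy).1
      subst this
      exact (hf' y' hy).2 e.symm
  rw [← c1, ← c2, ← Finset.card_union_of_disjoint d1, ← Finset.card_union_of_disjoint d2,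
    ← Finset.card_union_of_disjoint d3]
  refine Finset.card_le_card fun v hv ↦ ?_
  simp only [Finset.mem_union, Finset.mem_image] at hv
  rcases hv with ((hv | hv) | ⟨y, hy, rfl⟩) | ⟨y, hy, rfl⟩
  · exact (hK v hv).1
  · exact (hR v hv).1
  · exact (hf y hy).1
  · exact (hf' y hy).1.1

/-- Connecting vertices with a common neighbour `p` and a single private vertex each can be
replaced by a single vertex. -/
theorem exists_common_neighbor [Finite V] (hX : G.IsVertexCover X)
    (hP : ¬ (pathGraph 7).IsIndContained G) (hC : ¬ (cycleGraph 6).IsIndContained G)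
    (hΔ₁ : ¬ deltaOne.IsIndContained G) (hΔ₂ : ¬ deltaTwo.IsIndContained G)
    {T : Finset V} (hT : T.Nonempty) {p : V} (hp : p ∈ X) {f : V → V} (hTX : ∀ y ∈ T, y ∉ X)
    (hTp : ∀ y ∈ T, G.Adj y p) (hTf : ∀ y ∈ T, G.Adj y (f y))
    (hf : ∀ y ∈ T, ∀ u ∈ X, ¬ G.Adj (f y) u)
    (hTf' : ∀ y ∈ T, ∀ y' ∈ T, y' ≠ y → ¬ G.Adj y' (f y))
    (hz : ∀ y ∈ T, ∃ z, z ≠ y ∧ G.Adj z (f y)) :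
    ∃ z ∉ X, G.Adj z p ∧ ∀ y ∈ T, G.Adj z (f y) := by
  have hfX : ∀ y ∈ T, f y ∈ X := fun y hy ↦ (hX (hTf y hy)).resolve_left (hTX y hy)
  have hZX : ∀ y ∈ T, ∀ z, G.Adj z (f y) → z ∉ X := fun y hy z h hzX ↦ hf y hy z hzX h.symm
  let Z : V → Set V := fun y ↦ {z | z ≠ y ∧ G.Adj z (f y)}
  -- Incomparable sets `Z y`, `Z y'` would give two legs at `p`, hence one of the seven-vertex
  -- obstructions. So a smallest `Z y₀` lies in all the others.
  have hchain : ∀ y ∈ T, ∀ y' ∈ T, Z y ⊆ Z y' ∨ Z y' ⊆ Z y := by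
    intro y hy y' hy'
    by_contra! hcon
    obtain ⟨z, hz, hzn⟩ := Set.not_subset.1 hcon.1
    obtain ⟨z', hz', hzn'⟩ := Set.not_subset.1 hcon.2
    have hne : y ≠ y' := by
      rintro rfl
      exact hzn hz
    have n1 : ¬ G.Adj z (f y') := fun h ↦ hzn
      ⟨fun e ↦ hTf' y hy y' hy' hne.symm (e ▸ hz.2), h⟩
    have n2 : ¬ G.Adj z' (f y) := fun h ↦ hzn'
      ⟨fun e ↦ hTf' y' hy' y hy hne (e ▸ hz'.2), h⟩
    rcases isIndContained_of_two_legs hX (hTX y hy) (hTX y' hy') (hZX y hy z hz.2)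
      (hZX y' hy' z' hz'.2) (hTf y hy) hz.2 (hTf y' hy') hz'.2 (hTp y hy) (hTp y' hy')
      (hf y hy _ (hfX y' hy')) (hf y hy _ hp) (hf y' hy' _ hp) (hTf' y' hy' y hy hne)
      (hTf' y hy y' hy' hne.symm) n1 n2 hz.1.symm hz'.1.symm with h | h | h
    exacts [hP h, hΔ₁ h, hΔ₂ h]
  obtain ⟨y₀, hy₀, hmin⟩ := Finset.exists_min_image T (fun y ↦ (Z y).ncard) hT
  have hsub : ∀ y ∈ T, Z y₀ ⊆ Z y := by
    intro y hy
    rcases hchain y₀ hy₀ y hy with h | h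
    · exact h
    · exact (Set.eq_of_subset_of_ncard_le h (hmin y hy) (Set.toFinite _)).symm.subset
  by_cases hone : ∀ y ∈ T, y = y₀
  · refine ⟨y₀, hTX y₀ hy₀, hTp y₀ hy₀, fun y hy ↦ ?_⟩
    rw [hone y hy]
    exact hTf y₀ hy₀
  · push Not at hone
    obtain ⟨y₁, hy₁, hne⟩ := hone
    obtain ⟨z, hz⟩ := hz y₀ hy₀
    -- If `z` were not adjacent to `p`, then `p, y₀, f y₀, z, f y₁, y₁` would be an induced 6-cycle.
    refine ⟨z, hZX y₀ hy₀ z hz.2, ?_, fun y hy ↦ (hsub y hy hz).2⟩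
    by_contra hzp
    exact hC (cycleGraph_six_isIndContained hX (hTX y₀ hy₀) (hTX y₁ hy₁) (hZX y₀ hy₀ z hz.2)
      (hTf y₀ hy₀) hz.2 (hTf y₁ hy₁) (hsub y₁ hy₁ hz).2 (hTp y₀ hy₀) (hTp y₁ hy₁)
      (hf y₀ hy₀ _ (hfX y₁ hy₁)) (hf y₀ hy₀ _ hp) (hf y₁ hy₁ _ hp)
      (hTf' y₁ hy₁ y₀ hy₀ hne.symm) (hTf' y₀ hy₀ y₁ hy₁ hne) hzp)

theorem exists_small_connector [Fintype V] (hX : G.IsVertexCover X)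
    (hlink : ∀ v ∈ X, Linked G X k v)
    (hswap : ∀ x ∈ X, (∀ u ∈ X, ¬ G.Adj x u) → ∀ y ∉ X, G.Adj y x → ∀ k ∈ X, k ≠ x → G.Adj y k →
      ∃ z, z ≠ y ∧ G.Adj z x)
    (hP : ¬ (pathGraph 7).IsIndContained G) (hC : ¬ (cycleGraph 6).IsIndContained G)
    (hΔ₁ : ¬ deltaOne.IsIndContained G) (hΔ₂ : ¬ deltaTwo.IsIndContained G) :
    ∃ Y, IsConnector G X k Y ∧ 2 * Y.card ≤ X.card := by
  classical
  obtain ⟨Y, hY, hpriv⟩ := exists_connector_with_private hlink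
  choose! f hf using hpriv
  let Y₁ := Y.filter fun y ↦ ∃ v, IsPrivate G X Y k y v ∧ v ≠ f y
  let Y₂ := Y.filter fun y ↦ ¬ ∃ v, IsPrivate G X Y k y v ∧ v ≠ f y
  let K := X.filter fun v ↦ ReachableIn G X v k
  let R := X.filter fun v ↦ ¬ ReachableIn G X v k ∧ ∀ y ∈ Y, ¬ IsPrivate G X Y k y v
  have hY₁ : ∀ y ∈ Y₁, ∃ v, IsPrivate G X Y k y v ∧ v ≠ f y := fun y hy ↦
    (Finset.mem_filter.1 hy).2
  have hY₂ : ∀ y ∈ Y₂, y ∈ Y ∧ ∀ v, IsPrivate G X Y k y v → v = f y := by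
    intro y hy
    obtain ⟨hy, h⟩ := Finset.mem_filter.1 hy
    push Not at h
    exact ⟨hy, h⟩
  have hcardY : Y₁.card + Y₂.card = Y.card := Finset.card_filter_add_card_filter_not _
  have hcardX : K.card + R.card + Y.card + Y₁.card ≤ X.card := by
    choose! f' hf' using hY₁
    exact card_add_card_le_of_private (fun v hv ↦ Finset.mem_filter.1 hv)
      (fun v hv ↦ Finset.mem_filter.1 hv) (Finset.filter_subset _ _) hf hf'
  -- Here `2|Y| = |Y| + |Y₁| + |Y₂| ≤ |X|`. Otherwise the replacement has at most `|Y₁| + |K| + |R|`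
  -- elements, and `|K| + |R| < |Y₂|` gives the same bound.
  by_cases hsmall : Y₂.card ≤ K.card + R.card
  · exact ⟨Y, hY, by omega⟩
  -- Being private depends only on the component, so a single private vertex is a component by
  -- itself.
  have hf₂ : ∀ y ∈ Y₂, ∀ u, ReachableIn G X u (f y) → u = f y := by
    intro y hy u hu
    obtain ⟨h1, h2, h3, h4⟩ := hf y (hY₂ y hy).1
    exact (hY₂ y hy).2 u ⟨hu.mem_left, fun h ↦ h2 (hu.symm.trans h), h3.congr hu.symm,
      fun y' hy' h ↦ h4 y' hy' (h.congr hu)⟩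
  have hadj : ∀ y ∈ Y₂, G.Adj y (f y) := by
    intro y hy
    obtain ⟨u, hu, hyu⟩ := (hf y (hY₂ y hy).1).2.2.1
    rwa [hf₂ y hy u hu] at hyu
  have hiso : ∀ y ∈ Y₂, ∀ u ∈ X, ¬ G.Adj (f y) u := by
    intro y hy u hu h
    have := hf₂ y hy u (.of_adj hu (hf y (hY₂ y hy).1).1 h.symm)
    exact h.ne this.symm
  have hother : ∀ y ∈ Y₂, ∀ y' ∈ Y₂, y' ≠ y → ¬ G.Adj y' (f y) := fun y hy y' hy' hne h ↦
    have := hf y (hY₂ y hy).1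
    hne (this.2.2.2 y' (hY₂ y' hy').1 (.of_adj this.1 h))
  have hz : ∀ y ∈ Y₂, ∃ z, z ≠ y ∧ G.Adj z (f y) := by
    intro y hy
    obtain ⟨hyX, u, huk, hyu⟩ := hY.1 y (hY₂ y hy).1
    have hfy := hf y (hY₂ y hy).1
    exact hswap (f y) hfy.1 (hiso y hy) y hyX (hadj y hy) u huk.mem_left
      (fun e ↦ hfy.2.1 (e ▸ huk)) hyu
  have hg : ∀ v ∈ K ∪ R, ∃ z, (z ∉ X ∧ Attached G X z k) ∧
      (v ∈ K → ∀ y ∈ Y₂, G.Adj y v → G.Adj z (f y)) ∧ (v ∈ R → Attached G X z v) := by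
    intro v hv
    rcases Finset.mem_union.1 hv with hv | hv
    · have hvX := (Finset.mem_filter.1 hv).1
      have hvk := (Finset.mem_filter.1 hv).2
      have hvR : v ∉ R := fun h ↦ (Finset.mem_filter.1 h).2.1 hvk
      let T := Y₂.filter fun y ↦ G.Adj y v
      have hT : ∀ y ∈ T, y ∈ Y₂ ∧ G.Adj y v := fun y hy ↦ Finset.mem_filter.1 hy
      rcases T.eq_empty_or_nonempty with hTe | hTn
      -- Nothing has to be replaced at `v`; any vertex attached to `K` serves as a default, and `Y₂`
      -- is nonempty because it is larger than `K` and `R` together.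
      · obtain ⟨y, hy⟩ := Finset.card_pos.1 (by omega : 0 < Y₂.card)
        refine ⟨y, hY.1 y (hY₂ y hy).1, fun _ y' hy' h ↦ ?_, fun h ↦ absurd h hvR⟩
        exact absurd (hTe ▸ Finset.mem_filter.2 ⟨hy', h⟩ : y' ∈ (∅ : Finset V)) (by simp)
      · obtain ⟨z, hzX, hzv, hz⟩ := exists_common_neighbor hX hP hC hΔ₁ hΔ₂ hTn hvX (f := f)
          (fun y hy ↦ (hY.1 y (hY₂ y (hT y hy).1).1).1) (fun y hy ↦ (hT y hy).2)
          (fun y hy ↦ hadj y (hT y hy).1) (fun y hy ↦ hiso y (hT y hy).1)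
          (fun y hy y' hy' ↦ hother y (hT y hy).1 y' (hT y' hy').1)
          (fun y hy ↦ hz y (hT y hy).1)
        exact ⟨z, ⟨hzX, v, hvk, hzv⟩, fun _ y hy h ↦ hz y (Finset.mem_filter.2 ⟨hy, h⟩),
          fun h ↦ absurd h hvR⟩
    · obtain ⟨hvX, hvk, _⟩ := Finset.mem_filter.1 hv
      obtain ⟨y, hy, hyv⟩ := hY.2 v hvX hvk
      exact ⟨y, hY.1 y hy, fun h ↦ absurd (Finset.mem_filter.1 h).2 hvk, fun _ ↦ hyv⟩
  choose! g hg using hg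
  refine ⟨Y₁ ∪ (K ∪ R).image g, ⟨fun y hy ↦ ?_, fun v hv hvk ↦ ?_⟩, ?_⟩
  · rcases Finset.mem_union.1 hy with hy | hy
    · exact hY.1 y (Finset.mem_filter.1 hy).1
    · obtain ⟨v, hv, rfl⟩ := Finset.mem_image.1 hy
      exact (hg v hv).1
  · by_cases hvR : v ∈ R
    · exact ⟨g v, Finset.mem_union_right _ (Finset.mem_image_of_mem _
        (Finset.mem_union_right _ hvR)), (hg v (Finset.mem_union_right _ hvR)).2.2 hvR⟩
    · have : ∃ y ∈ Y, IsPrivate G X Y k y v := by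
        by_contra! hcon
        exact hvR (Finset.mem_filter.2 ⟨hv, hvk, hcon⟩)
      obtain ⟨y, hy, hyv⟩ := this
      by_cases hy₁ : y ∈ Y₁
      · exact ⟨y, Finset.mem_union_left _ hy₁, hyv.2.2.1⟩
      · have hy₂ : y ∈ Y₂ := Finset.mem_filter.2 ⟨hy, fun h ↦ hy₁ (Finset.mem_filter.2 ⟨hy, h⟩)⟩
        obtain ⟨p, hpk, hyp⟩ := (hY.1 y hy).2
        have hpK : p ∈ K := Finset.mem_filter.2 ⟨hpk.mem_left, hpk⟩
        refine ⟨g p, Finset.mem_union_right _ (Finset.mem_image_of_mem _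
          (Finset.mem_union_left _ hpK)), .of_adj hv ?_⟩
        rw [(hY₂ y hy₂).2 v hyv]
        exact (hg p (Finset.mem_union_left _ hpK)).2.1 hpK y hy₂ hyp
  · have h1 := Finset.card_union_le Y₁ ((K ∪ R).image g)
    have h2 := Finset.card_image_le (s := K ∪ R) (f := g)
    have h3 := Finset.card_union_le K R
    omega

end Connectors

/-! ### From connected graphs to all graphs -/

/-- A connected graph with an edge that avoids the four obstructions has a connected vertex cover
that is at most `3 / 2` times as large as any vertex cover. -/
theorem exists_connected_cover {V : Type*} [Finite V] {G : SimpleGraph V} (hG : G.Connected)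
    (hE : G ≠ ⊥) (hP : ¬ (pathGraph 7).IsIndContained G) (hC : ¬ (cycleGraph 6).IsIndContained G)
    (hΔ₁ : ¬ deltaOne.IsIndContained G) (hΔ₂ : ¬ deltaTwo.IsIndContained G) :
    ∃ C : Set V, G.IsVertexCover C ∧ (G.induce C).Connected ∧
      ∀ X, G.IsVertexCover X → 2 * C.ncard ≤ 3 * X.ncard := by
  classical
  have := Fintype.ofFinite V
  obtain ⟨X, hX, hmin, hswap⟩ := exists_minimum_vertexCover G
  have hne : (X : Set V).Nonempty := by
    rw [Set.nonempty_iff_ne_empty]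
    intro h
    rw [h, isVertexCover_empty] at hX
    exact hE hX
  obtain ⟨k, hk, hlink⟩ := exists_forall_linked hG hX hne hP
  obtain ⟨Y, hY, hcard⟩ := exists_small_connector hX hlink hswap hP hC hΔ₁ hΔ₂
  refine ⟨X ∪ Y, hX.subset Set.subset_union_left,
    induce_union_connected hk (fun y hy ↦ (hY.1 y hy).2) hY.2, fun X' hX' ↦ ?_⟩
  have h1 := Set.ncard_union_le (X : Set V) Y
  rw [Set.ncard_coe_finset, Set.ncard_coe_finset] at h1
  have h2 := hmin X'.toFinset (by simpa using hX')
  rw [← Set.ncard_eq_toFinset_card'] at h2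
  omega

theorem sum_ncard_preimage_connectedComponent {V : Type*} [Finite V] (G : SimpleGraph V)
    [Fintype G.ConnectedComponent] (S : Set V) :
    S.ncard = ∑ D : G.ConnectedComponent, ((↑) ⁻¹' S : Set D.supp).ncard := by
  classical
  have := Fintype.ofFinite V
  rw [Set.ncard_eq_toFinset_card' S, Finset.card_eq_sum_card_fiberwise
    (f := G.connectedComponentMk) (t := Finset.univ) (fun _ _ ↦ by simp)]
  refine Finset.sum_congr rfl fun D _ ↦ ?_
  rw [← Set.ncard_image_of_injective _ Subtype.val_injective, Subtype.image_preimage_coe,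
    ← Set.ncard_coe_finset]
  congr 1
  ext v
  simp [and_comm]

theorem connectedVertexCoverNum_le {V : Type*} [Finite V] {G : SimpleGraph V}
    (hP : ¬ (pathGraph 7).IsIndContained G) (hC : ¬ (cycleGraph 6).IsIndContained G)
    (hΔ₁ : ¬ deltaOne.IsIndContained G) (hΔ₂ : ¬ deltaTwo.IsIndContained G) :
    (connectedVertexCoverNum G : ℝ≥0∞) ≤ 3 / 2 * (G.vertexCoverNum : ℝ≥0∞) := by
  classical
  have := Fintype.ofFinite G.ConnectedComponent
  have hD : ∀ D : G.ConnectedComponent, ∃ C : Set D.supp, (G.induce D.supp).IsVertexCover C ∧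
      (D.supp.Nontrivial → ((G.induce D.supp).induce C).Connected) ∧
      (C.Nonempty → D.supp.Nontrivial) ∧
      ∀ X, (G.induce D.supp).IsVertexCover X → 2 * C.ncard ≤ 3 * X.ncard := by
    intro D
    by_cases hn : D.supp.Nontrivial
    · have hle : (G.induce D.supp).IsIndContained G := ⟨Embedding.induce _⟩
      have hcon : (G.induce D.supp).Connected := D.connected_toSimpleGraph
      have hE : G.induce D.supp ≠ ⊥ := by
        intro h
        have := hn.coe_sort
        rw [h] at hcon
        exact not_connected_bot hcon
      obtain ⟨C, h1, h2, h3⟩ := exists_connected_cover hcon hE (fun h ↦ hP (h.trans hle))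
        (fun h ↦ hC (h.trans hle)) (fun h ↦ hΔ₁ (h.trans hle)) (fun h ↦ hΔ₂ (h.trans hle))
      exact ⟨C, h1, fun _ ↦ h2, fun _ ↦ hn, h3⟩
    -- An isolated vertex must contribute nothing, since its component is not counted.
    · refine ⟨∅, ?_, fun h ↦ absurd h hn, fun h ↦ absurd h (by simp), by simp⟩
      have : Subsingleton D.supp := (Set.not_nontrivial_iff.1 hn).coe_sort
      exact fun u v h ↦ absurd (Subsingleton.elim u v) h.ne
  choose C hcov hconn hnon hcard using hD
  let U : Set V := {v | (⟨v, rfl⟩ : (G.connectedComponentMk v).supp) ∈ C (G.connectedComponentMk v)}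
  have hU : ∀ (D : G.ConnectedComponent) v (h : v ∈ D.supp), v ∈ U ↔ ⟨v, h⟩ ∈ C D := by
    rintro D v h
    obtain rfl : G.connectedComponentMk v = D := h
    rfl
  have hUD : ∀ D : G.ConnectedComponent, ((↑) ⁻¹' U : Set D.supp) = C D := fun D ↦
    Set.ext fun v ↦ hU D v v.2
  have hUcov : G.IsVertexCover U := by
    intro u v h
    have hv : v ∈ (G.connectedComponentMk u).supp :=
      (ConnectedComponent.connectedComponentMk_eq_of_adj h).symm
    rw [hU _ u rfl, hU _ v hv]
    exact hcov _ (by simpa using h)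
  -- Sending a component of `G[U]` to the component of `G` around it is a bijection onto the
  -- nontrivial ones, which is the required count.
  let m : (G.induce U).ConnectedComponent → G.ConnectedComponent :=
    ConnectedComponent.map (Embedding.induce U).toHom
  have hinj : Function.Injective m := by
    intro A B
    induction A using ConnectedComponent.ind with | _ u
    induction B using ConnectedComponent.ind with | _ v
    intro h
    have hv : (v : V) ∈ (G.connectedComponentMk u).supp := Eq.symm h
    have hu' := (hU _ u rfl).1 u.2
    have hv' := (hU _ v hv).1 v.2
    have hr := hconn _ (hnon _ ⟨_, hu'⟩) ⟨_, hu'⟩ ⟨_, hv'⟩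
    let F : ((G.induce (G.connectedComponentMk (u : V)).supp).induce (C _)) →g G.induce U :=
      ⟨fun x ↦ ⟨x.1.1, (hU _ x.1.1 x.1.2).2 x.2⟩, fun h ↦ h⟩
    exact ConnectedComponent.sound (hr.map F)
  have hrange : Set.range m = {D | D.supp.Nontrivial} := by
    ext D
    constructor
    · rintro ⟨A, rfl⟩
      induction A using ConnectedComponent.ind with | _ u
      exact hnon _ ⟨_, (hU _ u rfl).1 u.2⟩
    · intro hD
      obtain ⟨⟨v, hv⟩⟩ := (hconn D hD).nonempty
      exact ⟨(G.induce U).connectedComponentMk ⟨v, (hU D v v.2).2 hv⟩, v.2⟩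
  have hUc : IsConnectedVertexCover G U := ⟨hUcov,
    ENat.card_congr ((Equiv.ofInjective m hinj).trans (Equiv.setCongr hrange))⟩
  obtain ⟨X, hXcard, hX⟩ := G.vertexCoverNum_exists
  have h2 : 2 * U.ncard ≤ 3 * X.ncard := by
    rw [sum_ncard_preimage_connectedComponent G U, sum_ncard_preimage_connectedComponent G X,
      Finset.mul_sum, Finset.mul_sum]
    refine Finset.sum_le_sum fun D _ ↦ ?_
    rw [hUD]
    exact hcard D _ fun u v h ↦ hX h
  have h1 : connectedVertexCoverNum G ≤ U.encard := iInf₂_le U hUc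
  rw [← hXcard]
  refine (ENat.toENNReal_le.2 h1).trans ?_
  rw [← U.toFinite.cast_ncard_eq, ← X.toFinite.cast_ncard_eq]
  simp only [ENat.toENNReal_coe]
  have h3 : (2 : ℝ≥0∞) * U.ncard ≤ 3 * X.ncard := by exact_mod_cast h2
  rw [ENNReal.div_eq_inv_mul, mul_assoc]
  exact (ENNReal.mul_le_iff_le_inv (by simp) (by simp)).1 h3

/-! ### Necessity: the obstructions violate the bound -/

section Obstructions

theorem IsConnectedVertexCover.preconnected {V : Type*} {G : SimpleGraph V} [Nontrivial V]
    (hG : G.Connected) {C : Set V} (hC : IsConnectedVertexCover G C) :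
    (G.induce C).Preconnected := by
  have hsub := hG.preconnected.subsingleton_connectedComponent
  have h1 : ENat.card {D : G.ConnectedComponent // D.supp.Nontrivial} ≤ 1 := by
    rw [ENat.card_le_one_iff_subsingleton]
    infer_instance
  rw [← hC.2, ENat.card_le_one_iff_subsingleton] at h1
  exact fun u v ↦ ConnectedComponent.exact (Subsingleton.elim _ _)

/-- Transports a lower bound along an isomorphism. Preconnectedness is all that the cut argument
uses of a connected cover. -/
theorem le_connectedVertexCoverNum {V W : Type*} {L : SimpleGraph V} {H : SimpleGraph W}
    [Nontrivial V] (hL : L.Connected) (e : L ≃g H) {n : ℕ∞}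
    (h : ∀ C, L.IsVertexCover C → (L.induce C).Preconnected → n ≤ C.encard) :
    n ≤ connectedVertexCoverNum H := by
  refine le_iInf₂ fun C hC ↦ ?_
  have := e.toEquiv.nontrivial_congr.1 ‹_›
  have hpre := hC.preconnected (e.connected_iff.1 hL)
  have h1 := h (e ⁻¹' C) (hC.1.preimage e)
    ((Iso.induce e (s := e ⁻¹' C) (t := C) ⟨fun _ h ↦ h, e.injective.injOn,
      fun v hv ↦ ⟨e.symm v, by simpa using hv, by simp⟩⟩).preconnected_iff.2 hpre)
  rwa [Set.encard_preimage_of_bijective e.bijective] at h1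

theorem exists_adj_of_preconnected_induce {V : Type*} {G : SimpleGraph V} {C : Set V}
    (h : (G.induce C).Preconnected) (A : Set V) {a b : V} (ha : a ∈ C) (haA : a ∈ A) (hb : b ∈ C)
    (hbA : b ∉ A) : ∃ u ∈ C, ∃ v ∈ C, G.Adj u v ∧ u ∈ A ∧ v ∉ A := by
  by_contra! hcon
  have key : ∀ u v : C, (G.induce C).Walk u v → (u : V) ∈ A → (v : V) ∈ A := by
    intro u v p
    induction p with
    | nil => exact id
    | @cons u v w huv p ih => exact fun hu ↦ ih (hcon u u.2 v v.2 (by simpa using huv) hu)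
  obtain ⟨p⟩ := h ⟨a, ha⟩ ⟨b, hb⟩
  exact hbA (key _ _ p haA)

/-- A connected graph with edge list `E` that has a vertex cover `X` with three vertices, and in
which each vertex cover with at most four vertices is disconnected by one of the cuts in `A`. -/
theorem not_isIndContained_of_cuts {n : ℕ} [Nontrivial (Fin n)] {L : SimpleGraph (Fin n)}
    (hL : L.Connected) (E : Finset (Fin n × Fin n))
    (hE : ∀ u v, L.Adj u v ↔ (u, v) ∈ E ∨ (v, u) ∈ E) (X : Finset (Fin n)) (hX : X.card = 3)
    (hXE : ∀ e ∈ E, e.1 ∈ X ∨ e.2 ∈ X) (A : Finset (Finset (Fin n)))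
    (hA : ∀ s : Finset (Fin n), (∀ e ∈ E, e.1 ∈ s ∨ e.2 ∈ s) → s.card ≤ 4 →
      ∃ a ∈ A, (∃ u ∈ s, u ∈ a) ∧ (∃ u ∈ s, u ∉ a) ∧
        ∀ e ∈ E, e.1 ∈ s → e.2 ∈ s → (e.1 ∈ a ↔ e.2 ∈ a))
    {V : Type*} {G : SimpleGraph V}
    (h : ∀ S : Set V, (connectedVertexCoverNum (G.induce S) : ℝ≥0∞) ≤
      3 / 2 * ((G.induce S).vertexCoverNum : ℝ≥0∞)) : ¬ L.IsIndContained G := by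
  classical
  rw [isIndContained_iff_exists_iso_induce]
  rintro ⟨S, ⟨e⟩⟩
  have hcov : L.IsVertexCover X := by
    intro u v huv
    rcases (hE u v).1 huv with h | h
    · exact hXE _ h
    · exact (hXE _ h).symm
  have h1 : (G.induce S).vertexCoverNum ≤ 3 := by
    rw [← vertexCoverNum_congr e]
    refine hcov.vertexCoverNum_le.trans ?_
    rw [Set.encard_coe_eq_coe_finsetCard, hX]
    rfl
  have h2 : 5 ≤ connectedVertexCoverNum (G.induce S) := by
    refine le_connectedVertexCoverNum hL e fun C hC hpre ↦ ?_
    obtain ⟨s, rfl⟩ : ∃ s : Finset (Fin n), C = s := ⟨C.toFinset, by simp⟩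
    rw [Set.encard_coe_eq_coe_finsetCard]
    by_contra hlt
    have hcard : s.card ≤ 4 := by
      by_contra hgt
      exact hlt (by exact_mod_cast (by omega : 5 ≤ s.card))
    obtain ⟨a, -, ⟨u, hu, hua⟩, ⟨v, hv, hva⟩, hcut⟩ :=
      hA s (fun e he ↦ hC ((hE _ _).2 (.inl he))) hcard
    obtain ⟨x, hx, y, hy, hxy, hxa, hya⟩ :=
      exists_adj_of_preconnected_induce hpre (a : Set (Fin n)) hu hua hv hva
    rcases (hE x y).1 hxy with h | h
    · exact hya ((hcut _ h hx hy).1 hxa)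
    · exact hya ((hcut _ h hy hx).2 hxa)
  -- The bound would give `5 ≤ 3 / 2 * 3`, that is `10 ≤ 9`.
  have h3 := (ENat.toENNReal_le.2 h2).trans ((h S).trans (mul_le_mul_right (ENat.toENNReal_le.2 h1) _))
  rw [ENNReal.div_eq_inv_mul, mul_assoc, ← ENNReal.mul_le_iff_le_inv (by simp) (by simp)] at h3
  have h4 : (2 : ℝ≥0∞) * ((5 : ℕ) : ℕ∞) ≤ 3 * ((3 : ℕ) : ℕ∞) := h3
  simp only [ENat.toENNReal_coe] at h4
  have h5 : 2 * 5 ≤ 3 * 3 := by exact_mod_cast h4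
  omega

end Obstructions

section Deltas

theorem deltaTwo_le_deltaOne : deltaTwo ≤ deltaOne := deleteEdges_le _

theorem deltaTwo_connected : deltaTwo.Connected := by
  have h : ∀ u v : Fin 7, deltaTwo.Adj u v ↔ (u, v) ∈ ({(1, 2), (2, 3), (3, 0), (0, 4), (4, 5),
      (5, 6), (6, 0)} : Finset (Fin 7 × Fin 7)) ∨ (v, u) ∈ ({(1, 2), (2, 3), (3, 0), (0, 4),
      (4, 5), (5, 6), (6, 0)} : Finset (Fin 7 × Fin 7)) := by
    simp [deltaTwo, deltaOne, Fin.forall_fin_succ]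
  have h03 : deltaTwo.Reachable 0 3 := ((h 0 3).2 (by decide)).reachable
  have h02 := h03.trans ((h 3 2).2 (by decide)).reachable
  have h01 := h02.trans ((h 2 1).2 (by decide)).reachable
  have h04 : deltaTwo.Reachable 0 4 := ((h 0 4).2 (by decide)).reachable
  have h05 := h04.trans ((h 4 5).2 (by decide)).reachable
  have h06 := h05.trans ((h 5 6).2 (by decide)).reachable
  rw [connected_iff_exists_forall_reachable]
  refine ⟨0, fun w ↦ ?_⟩
  fin_cases w
  exacts [Reachable.refl _, h01, h02, h03, h04, h05, h06]

end Deltas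

set_option maxRecDepth 10000 in
set_option synthInstance.maxHeartbeats 200000 in
set_option synthInstance.maxSize 1000 in
theorem not_isIndContained_of_forall_le {V : Type*} {G : SimpleGraph V}
    (h : ∀ S : Set V, (connectedVertexCoverNum (G.induce S) : ℝ≥0∞) ≤
      3 / 2 * ((G.induce S).vertexCoverNum : ℝ≥0∞)) :
    ¬ (pathGraph 7).IsIndContained G ∧ ¬ (cycleGraph 6).IsIndContained G ∧
      ¬ deltaOne.IsIndContained G ∧ ¬ deltaTwo.IsIndContained G := by
  refine ⟨?_, ?_, ?_, ?_⟩
  · exact not_isIndContained_of_cuts (pathGraph_connected 6)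
      {(0, 1), (1, 2), (2, 3), (3, 4), (4, 5), (5, 6)}
      (by simp [Fin.forall_fin_succ, pathGraph_adj])
      -- A cover missing 2 or 3 is split by `{0, 1, 2}`. One containing both and having at most four
      -- vertices needs 5 and one of 0, 1, so it misses 4 and 6 and is split by `{5}`. The cuts for
      -- the other graphs play the same role.
      {1, 3, 5} rfl (by decide) {{0, 1, 2}, {5}} (by decide) h
  · exact not_isIndContained_of_cuts (cycleGraph_connected (n := 5))
      {(0, 1), (1, 2), (2, 3), (3, 4), (4, 5), (5, 0)}
      (by decide)
      {1, 3, 5} rfl (by decide) {{0, 1, 2}, {0, 5}, {2, 3}} (by decide) h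
  · exact not_isIndContained_of_cuts (deltaTwo_connected.mono deltaTwo_le_deltaOne)
      {(0, 1), (1, 2), (2, 3), (3, 0), (0, 4), (4, 5), (5, 6), (6, 0)}
      (by simp [Fin.forall_fin_succ, deltaOne])
      {0, 2, 5} rfl (by decide) {{1, 2}, {5}} (by decide) h
  · exact not_isIndContained_of_cuts deltaTwo_connected
      {(1, 2), (2, 3), (3, 0), (0, 4), (4, 5), (5, 6), (6, 0)}
      (by simp [Fin.forall_fin_succ, deltaTwo, deltaOne])
      {0, 2, 5} rfl (by decide) {{1, 2}, {4, 5}} (by decide) h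

theorem theorem4 {V : Type*} [Finite V] (G : SimpleGraph V) :
    (∀ S : Set V,
      (connectedVertexCoverNum (G.induce S) : ℝ≥0∞) ≤
        3 / 2 * ((G.induce S).vertexCoverNum : ℝ≥0∞)) ↔
    (¬ (pathGraph 7).IsIndContained G ∧ ¬ (cycleGraph 6).IsIndContained G ∧
      ¬ deltaOne.IsIndContained G ∧ ¬ deltaTwo.IsIndContained G) := by
  refine ⟨not_isIndContained_of_forall_le, fun ⟨hP, hC, hΔ₁, hΔ₂⟩ S ↦ ?_⟩
  have hle : (G.induce S).IsIndContained G := ⟨Embedding.induce S⟩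
  exact connectedVertexCoverNum_le (fun h ↦ hP (h.trans hle)) (fun h ↦ hC (h.trans hle))
    (fun h ↦ hΔ₁ (h.trans hle)) (fun h ↦ hΔ₂ (h.trans hle))
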